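/- Let $\mathbb{K}$ be a field of characteristic zero and let $\mathcal{S}$ be a signature, that is, a set with an arity map $\mathcal{S}\to\mathbb{N}$. Let $\mathfrak{T}(\mathcal{S})$ be the free nonsymmetric operad on $\mathcal{S}$. Its elements are the $\mathcal{S}$-terms, i.e. the planar rooted trees whose internal nodes with $n$ children are decorated by elements of $\mathcal{S}$ of arity $n$; the arity of a term is its number of leaves, its degree is its number of internal nodes, the unit is the tree reduced to one leaf, and $t[t_1,\dots,t_n]$ is obtained by grafting $t_i$ onto the $i$-th leaf of $t$. For an operad $\mathcal{O}$ with unit $\mathbf{1}$ in which every element $x$ has finitely many factorizations $x=y[w_1,\dots,w_n]$, and which admits a grading (a map $\deg:\mathcal{O}\to\mathbb{N}$, additive under composition, with $\deg^{-1}(0)=\{\mathbf{1}\}$), the natural Hopf algebra $\mathbf{N}(\mathcal{O})$ is the $\mathbb{K}$-vector space with basis $(\mathsf{E}_w)$ indexed by the reduced words $w\in(\mathcal{O}\setminus\{\mathbf{1}\})^*$. Its product is $\mathsf{E}_v\cdot\mathsf{E}_w=\mathsf{E}_{vw}$, and its coproduct is the algebra morphism such that, for $x\in\mathcal{O}\setminus\{\mathbf{1}\}$,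 $$\Delta(\mathsf{E}_x)=\sum_{x=y[w_1,\dots,w_n]}\mathsf{E}_{\mathrm{rd}(y)}\otimes\mathsf{E}_{\mathrm{rd}(w_1\cdots w_n)},$$ where the sum is over all factorizations of $x$ and $\mathrm{rd}$ removes from a word all letters equal to $\mathbf{1}$. Let $\equiv$ be an operad congruence of $\mathfrak{T}(\mathcal{S})$, i.e. an equivalence relation which preserves arities and is compatible with composition. Assume that $\equiv$ is compatible with the degree ($t\equiv t'$ implies $\deg t=\deg t'$) and of finite type (all its equivalence classes are finite). Let $\pi$ be the projection from words on $\mathfrak{T}(\mathcal{S})$ to words on $\mathfrak{T}(\mathcal{S})/_\equiv$ which replaces each letter by its class. Then $\mathfrak{T}(\mathcal{S})/_\equiv$ and $\mathfrak{T}(\mathcal{S})$ have natural Hopf algebras, and the linear map $$\phi:\mathbf{N}(\mathfrak{T}(\mathcal{S})/_\equiv)\to\mathbf{N}(\mathfrak{T}(\mathcal{S})),\qquad \phi(\mathsf{E}_x)=\sum_{f}\mathsf{E}_f,$$ where for each reduced word $x$ on $\mathfrak{T}(\mathcal{S})/_\equiv$ the sum is over the (finitely many) reduced forests $f$, i.e.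 words on the terms other than the leaf, such that $\pi(f)=x$, is an injective morphism of Hopf algebras: it is an injective linear map that preserves product, unit, coproduct, counit and antipode. -/

import Mathlib

open scoped TensorProduct

/-! ### Signatures and nonsymmetric operads -/

/-- A signature: a set endowed with an arity map. -/
structure Signature where
  carrier : Type*
  arity : carrier → ℕ

/-- A nonsymmetric (set-theoretic) operad. The inputs of a composite `x[y₁, …, yₙ]` are numbered
block by block, which is what `finSigmaFinEquiv` does. -/
structure NSOperad extends Signature where
  unit : carrier
  comp : (x : carrier) → (Fin (arity x) → carrier) → carrier
  arity_unit : arity unit = 1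
  arity_comp : ∀ x y, arity (comp x y) = ∑ i, arity (y i)
  unit_comp : ∀ x, comp unit (fun _ => x) = x
  comp_unit : ∀ x, comp x (fun _ => unit) = x
  comp_assoc : ∀ x y (z : Fin (arity (comp x y)) → carrier),
    comp (comp x y) z =
      comp x fun i => comp (y i) fun j =>
        z (Fin.cast (arity_comp x y).symm (finSigmaFinEquiv ⟨i, j⟩))

namespace NSOperad

variable (O : NSOperad)

/-- The factorizations `x = y[y'₁, …, y'ₙ]` of `x`. -/
def Factorization (x : O.carrier) :=
  {p : (y : O.carrier) × (Fin (O.arity y) → O.carrier) // O.comp p.1 p.2 = x}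

class FinitelyFactorizable : Prop where
  finite : ∀ x : O.carrier, Finite (O.Factorization x)

/-- `deg` is a grading of the operad `O`. -/
structure IsGrading (deg : O.carrier → ℕ) : Prop where
  eq_zero_iff : ∀ x, deg x = 0 ↔ x = O.unit
  comp : ∀ x y, deg (O.comp x y) = deg x + ∑ i, deg (y i)

class Graded : Prop where
  exists_grading : ∃ deg : O.carrier → ℕ, O.IsGrading deg

end NSOperad

/-! ### Numbering of the inputs of a composite -/

theorem finSigmaFinEquiv_lt_iff {m : ℕ} {n : Fin m → ℕ} (a b : (i : Fin m) × Fin (n i)) :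
    finSigmaFinEquiv a < finSigmaFinEquiv b ↔
      a.1 < b.1 ∨ (a.1 = b.1 ∧ (a.2 : ℕ) < b.2) := by
  have key : ∀ a b : (i : Fin m) × Fin (n i), a.1 < b.1 →
      finSigmaFinEquiv a < finSigmaFinEquiv b := by
    rintro ⟨i, j⟩ ⟨i', j'⟩ h
    rw [Fin.lt_def, finSigmaFinEquiv_apply, finSigmaFinEquiv_apply]
    simp only at h ⊢
    have h1 : ∑ k : Fin (i : ℕ), n (Fin.castLE i.2.le k) + n i
        = ∑ k : Fin (i + 1 : ℕ), n (Fin.castLE i.2 k) := by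
      rw [Fin.sum_univ_castSucc]; rfl
    have h2 : ∑ k : Fin (i + 1 : ℕ), n (Fin.castLE i.2 k)
        ≤ ∑ k : Fin (i' : ℕ), n (Fin.castLE i'.2.le k) := by
      have h3 : (i : ℕ) + 1 ≤ i' := h
      obtain ⟨d, hd⟩ := Nat.exists_eq_add_of_le h3
      have : ∑ k : Fin (i' : ℕ), n (Fin.castLE i'.2.le k)
        = ∑ k : Fin ((i + 1 : ℕ) + d), n (Fin.castLE (hd ▸ i'.2.le) k) := by
        refine Fintype.sum_equiv (finCongr hd) _ _ fun k => ?_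
        rfl
      rw [this, Fin.sum_univ_add (b := d)]
      exact Nat.le_add_right _ _
    have := j.2
    omega
  have key2 : ∀ (i : Fin m) (j j' : Fin (n i)),
      finSigmaFinEquiv (⟨i, j⟩ : (i : Fin m) × Fin (n i)) < finSigmaFinEquiv ⟨i, j'⟩ ↔
        (j : ℕ) < j' := by
    intro i j j'
    rw [Fin.lt_def, finSigmaFinEquiv_apply, finSigmaFinEquiv_apply]
    simp
  obtain ⟨i, j⟩ := a
  obtain ⟨i', j'⟩ := b
  rcases lt_trichotomy i i' with h | h | h
  · simp [h, key ⟨i, j⟩ ⟨i', j'⟩ h]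
  · subst h
    simp [key2 i j j']
  · have := key ⟨i', j'⟩ ⟨i, j⟩ h
    simp [this.not_gt, h.not_gt, h.ne']

theorem finSigmaFinEquiv_val {m : ℕ} {n : Fin m → ℕ} (i : Fin m) (j : Fin (n i)) :
    (finSigmaFinEquiv (⟨i, j⟩ : (i : Fin m) × Fin (n i)) : ℕ) =
      ∑ k ∈ Finset.univ.filter (· < i), n k + j := by
  rw [finSigmaFinEquiv_apply]
  congr 1
  refine Finset.sum_bij (fun k _ => Fin.castLE i.2.le k) ?_ ?_ ?_ ?_
  · intro k _; simpa using Fin.lt_def.2 k.2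
  · intro k _ l _ h; simpa [Fin.ext_iff] using h
  · intro k hk
    simp only [Finset.mem_filter, Finset.mem_univ, true_and] at hk
    exact ⟨⟨k, hk⟩, Finset.mem_univ _, rfl⟩
  · intro k _; rfl

theorem finSigmaFinEquiv_symm_apply' {α : Type*} {m : ℕ} {n : Fin m → ℕ}
    (v : ∀ i, Fin (n i) → α) (i : Fin m) (j : Fin (n i)) :
    v (finSigmaFinEquiv.symm (finSigmaFinEquiv ⟨i, j⟩)).1
      (finSigmaFinEquiv.symm (finSigmaFinEquiv ⟨i, j⟩)).2 = v i j := by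
  have h : ∀ q : (i : Fin m) × Fin (n i), q = ⟨i, j⟩ → v q.1 q.2 = v i j := by
    rintro _ rfl
    rfl
  exact h _ (Equiv.symm_apply_apply _ _)

/-- Numbering blocks of blocks of inputs does not depend on the order of the grouping. -/
theorem finSigmaFinEquiv_assoc {m : ℕ} {n : Fin m → ℕ} (a : Fin (∑ i, n i) → ℕ)
    (i : Fin m) (j : Fin (n i)) (k : Fin (a (finSigmaFinEquiv ⟨i, j⟩))) (b : Fin m → ℕ)
    (hb : ∀ i, b i = ∑ j, a (finSigmaFinEquiv ⟨i, j⟩)) :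
    (finSigmaFinEquiv (⟨i, Fin.cast (hb i).symm (finSigmaFinEquiv
        (⟨j, k⟩ : (j : Fin (n i)) × Fin (a (finSigmaFinEquiv ⟨i, j⟩))))⟩ :
          (i : Fin m) × Fin (b i)) : ℕ) =
      (finSigmaFinEquiv (⟨finSigmaFinEquiv ⟨i, j⟩, k⟩ : (l : Fin (∑ i, n i)) × Fin (a l)) : ℕ) := by
  rw [finSigmaFinEquiv_val, finSigmaFinEquiv_val, Fin.val_cast, finSigmaFinEquiv_val, ← add_assoc]
  congr 1
  rw [Finset.sum_filter, Finset.sum_filter, Finset.sum_filter]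
  rw [← Equiv.sum_comp finSigmaFinEquiv, Fintype.sum_sigma]
  simp only [finSigmaFinEquiv_lt_iff]
  have h1 : ∀ x : Fin m, (∑ y : Fin (n x), if x < i ∨ (x = i ∧ (y : ℕ) < j) then
      a (finSigmaFinEquiv ⟨x, y⟩) else 0) =
      (if x < i then b x else 0) +
        (if x = i then ∑ y : Fin (n i), (if y < j then a (finSigmaFinEquiv ⟨i, y⟩) else 0)
          else 0) := by
    intro x
    rcases lt_trichotomy x i with h | h | h
    · simp [h, h.ne, hb]
    · subst h
      simp
    · simp [h.not_gt, h.ne']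
  rw [Finset.sum_congr rfl fun x _ => h1 x, Finset.sum_add_distrib]
  simp

theorem ofFn_finSigmaFinEquiv {α : Type*} {m : ℕ} {n : Fin m → ℕ} (g : Fin (∑ i, n i) → α) :
    List.ofFn g =
      (List.ofFn fun i => List.ofFn fun j : Fin (n i) => g (finSigmaFinEquiv ⟨i, j⟩)).flatten := by
  induction m with
  | zero => simp
  | succ m ih =>
    have hs := Fin.sum_univ_castSucc n
    rw [List.ofFn_congr hs, List.ofFn_add, List.ofFn_succ', List.concat_eq_append,
      List.flatten_append, ih]
    congr 1
    · congr 2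
      funext i
      congr 1
      funext j
      congr 1
      apply Fin.ext
      simp [finSigmaFinEquiv_apply]
    · simp only [List.flatten_cons, List.flatten_nil, List.append_nil]
      congr 1
      funext j
      congr 1
      apply Fin.ext
      simp [finSigmaFinEquiv_apply]
      rfl

/-! ### Terms and free operads -/

/-- The terms on a signature. -/
inductive Term (S : Signature) where
  | leaf : Term S
  | node (s : S.carrier) (c : Fin (S.arity s) → Term S) : Term S

namespace Term

variable {S : Signature}

/-- The number of internal nodes. -/
def deg : Term S → ℕ
  | leaf => 0
  | node _ c => 1 + ∑ i, (c i).deg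

/-- The number of leaves. -/
def arity : Term S → ℕ
  | leaf => 1
  | node _ c => ∑ i, (c i).arity

/-- Grafting of the `i`-th term of `y` onto the `i`-th leaf of a term, from left to right. -/
def graft : (t : Term S) → (Fin t.arity → Term S) → Term S
  | leaf, y => y (0 : Fin 1)
  | node s c, y => node s fun i => (c i).graft fun j =>
      y (finSigmaFinEquiv (n := fun i => (c i).arity) ⟨i, j⟩)

theorem arity_graft (t : Term S) (y : Fin t.arity → Term S) :
    (t.graft y).arity = ∑ i, (y i).arity := by
  induction t with
  | leaf => exact (Fin.sum_univ_one fun i : Fin 1 => (y i).arity).symm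
  | node s c ih =>
    rw [graft, arity]
    simp only [ih]
    rw [← Fintype.sum_sigma']
    exact Equiv.sum_comp (finSigmaFinEquiv (n := fun i => (c i).arity)) (fun k => (y k).arity)

theorem deg_graft (t : Term S) (y : Fin t.arity → Term S) :
    (t.graft y).deg = t.deg + ∑ i, (y i).deg := by
  induction t with
  | leaf =>
    rw [graft, deg, zero_add]
    exact (Fin.sum_univ_one fun i : Fin 1 => (y i).deg).symm
  | node s c ih =>
    rw [graft, deg, deg]
    simp only [ih]
    rw [Finset.sum_add_distrib, add_assoc]
    congr 2
    rw [← Fintype.sum_sigma']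
    exact Equiv.sum_comp (finSigmaFinEquiv (n := fun i => (c i).arity)) (fun k => (y k).deg)

theorem graft_leaf (t : Term S) : t.graft (fun _ => leaf) = t := by
  induction t with
  | leaf => rfl
  | node s c ih =>
    rw [graft]
    simp only [ih]

theorem graft_assoc (t : Term S) (y : Fin t.arity → Term S)
    (z : Fin (t.graft y).arity → Term S) :
    (t.graft y).graft z = t.graft fun i => (y i).graft fun j =>
      z (Fin.cast (arity_graft t y).symm (finSigmaFinEquiv ⟨i, j⟩)) := by
  induction t with
  | leaf =>
    change (y (0 : Fin 1)).graft z = (y (0 : Fin 1)).graft _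
    congr 1
    funext j
    congr 1
    apply Fin.ext
    exact (finSigmaFinEquiv_one (n := fun i : Fin 1 => (y i).arity) ⟨0, j⟩).symm
  | node s c ih =>
    change node s _ = node s _
    congr 1
    funext i
    refine (ih i _ _).trans ?_
    congr 1
    funext j
    congr 1
    funext k
    congr 1
    apply Fin.ext
    exact finSigmaFinEquiv_assoc (n := fun i => (c i).arity) (fun l => (y l).arity) i j k
      (fun i => ((c i).graft fun j => y (finSigmaFinEquiv ⟨i, j⟩)).arity)
      (fun i => arity_graft _ _)

end Term

/-- The free operad on a signature. -/
def freeOperad (S : Signature) : NSOperad where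
  carrier := Term S
  arity := Term.arity
  unit := Term.leaf
  comp := Term.graft
  arity_unit := rfl
  arity_comp := Term.arity_graft
  unit_comp _ := rfl
  comp_unit := Term.graft_leaf
  comp_assoc := Term.graft_assoc

theorem Term.deg_eq_zero_iff {S : Signature} (t : Term S) : t.deg = 0 ↔ t = Term.leaf := by
  cases t with
  | leaf => simp [Term.deg]
  | node s c => simp [Term.deg]

theorem freeOperad_isGrading_deg (S : Signature) : (freeOperad S).IsGrading Term.deg where
  eq_zero_iff := Term.deg_eq_zero_iff
  comp := Term.deg_graft

instance freeOperad_graded (S : Signature) : (freeOperad S).Graded :=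
  ⟨⟨_, freeOperad_isGrading_deg S⟩⟩

instance freeOperad_finitelyFactorizable (S : Signature) :
    (freeOperad S).FinitelyFactorizable := by
  refine ⟨fun t => ?_⟩
  change Finite {p : (y : Term S) × (Fin y.arity → Term S) // p.1.graft p.2 = t}
  induction t with
  | leaf =>
    have : ∀ p : {p : (y : Term S) × (Fin y.arity → Term S) // p.1.graft p.2 = Term.leaf},
        p = ⟨⟨Term.leaf, fun _ => Term.leaf⟩, rfl⟩ := by
      rintro ⟨⟨y, w⟩, h⟩
      cases y with
      | leaf =>
        have : w = fun _ => Term.leaf := by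
          funext (i : Fin 1)
          rw [Subsingleton.elim i 0]
          exact h
        subst this
        rfl
      | node s c => simp [Term.graft] at h
    have : Subsingleton {p : (y : Term S) × (Fin y.arity → Term S) //
        p.1.graft p.2 = Term.leaf} := ⟨fun a b => by rw [this a, this b]⟩
    infer_instance
  | node s c ih =>
    let F : Option (∀ i, {p : (y : Term S) × (Fin y.arity → Term S) // p.1.graft p.2 = c i}) →
        {p : (y : Term S) × (Fin y.arity → Term S) // p.1.graft p.2 = Term.node s c} :=
      fun o => match o with
      | none => ⟨⟨Term.leaf, fun _ => Term.node s c⟩, rfl⟩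
      | some p => ⟨⟨Term.node s fun i => (p i).1.1, fun k =>
          (p (finSigmaFinEquiv.symm k).1).1.2 (finSigmaFinEquiv.symm k).2⟩, by
          rw [Term.graft]
          congr 1
          funext i
          refine Eq.trans ?_ (p i).2
          congr 1
          funext j
          exact finSigmaFinEquiv_symm_apply' (fun i => (p i).1.2) i j⟩
    refine Finite.of_surjective F ?_
    rintro ⟨⟨y, w⟩, h⟩
    cases y with
    | leaf =>
      refine ⟨none, ?_⟩
      apply Subtype.ext
      have : w = fun _ => Term.node s c := by
        funext (i : Fin 1)
        rw [Subsingleton.elim i 0]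
        exact h
      subst this
      rfl
    | node s' c' =>
      simp only [Term.graft] at h
      injection h with h1 h2
      subst h1
      have h2 := eq_of_heq h2
      subst h2
      refine ⟨some fun i => ⟨⟨c' i, fun j => w (finSigmaFinEquiv (n := fun i => (c' i).arity)
        ⟨i, j⟩)⟩, rfl⟩, ?_⟩
      apply Subtype.ext
      simp only [F]
      congr 1
      funext k
      exact congrArg w (Equiv.apply_symm_apply (finSigmaFinEquiv (n := fun i => (c' i).arity)) k)

/-! ### Congruences and quotients of operads -/

namespace NSOperad

variable (O : NSOperad)

/-- An operad congruence: an equivalence relation which preserves the arities and is compatible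
with the composition. -/
structure Congruence extends Setoid O.carrier where
  arity_eq : ∀ {x x' : O.carrier}, r x x' → O.arity x = O.arity x'
  comp_congr : ∀ {x x' : O.carrier} (h : r x x') (y : Fin (O.arity x) → O.carrier)
    (y' : Fin (O.arity x') → O.carrier), (∀ i, r (y i) (y' (Fin.cast (arity_eq h) i))) →
    r (O.comp x y) (O.comp x' y')

namespace Congruence

variable {O} (C : O.Congruence)

/-- The set of equivalence classes. -/
def Class := Quotient C.toSetoid

/-- The canonical projection. -/
def proj (x : O.carrier) : C.Class := Quotient.mk C.toSetoid x

theorem proj_eq_iff {x x' : O.carrier} : C.proj x = C.proj x' ↔ C.r x x' :=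
  Quotient.eq (r := C.toSetoid)

theorem proj_surjective : Function.Surjective C.proj := Quotient.mk_surjective

/-- The common arity of the elements of a class. -/
def classArity : C.Class → ℕ := Quotient.lift O.arity fun _ _ h => C.arity_eq h

/-- A representative of a class. -/
noncomputable def rep (q : C.Class) : O.carrier := Quotient.out q

theorem proj_rep (q : C.Class) : C.proj (C.rep q) = q := Quotient.out_eq q

theorem arity_rep (q : C.Class) : O.arity (C.rep q) = C.classArity q := by
  conv_rhs => rw [← C.proj_rep q]
  rfl

/-- The class of the composite of representatives; by `proj_comp` it does not depend on them. -/
noncomputable def classComp (q : C.Class) (y : Fin (C.classArity q) → C.Class) : C.Class :=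
  C.proj (O.comp (C.rep q) fun i => C.rep (y (Fin.cast (C.arity_rep q) i)))

theorem proj_comp (x : O.carrier) (y : Fin (O.arity x) → O.carrier) :
    C.proj (O.comp x y) = C.classComp (C.proj x) fun i => C.proj (y i) := by
  refine C.proj_eq_iff.2 (C.comp_congr (C.proj_eq_iff.1 (C.proj_rep _).symm) _ _ fun i => ?_)
  exact C.proj_eq_iff.1 (C.proj_rep _).symm

/-- The quotient operad. -/
noncomputable def quotient : NSOperad where
  carrier := C.Class
  arity := C.classArity
  unit := C.proj O.unit
  comp := C.classComp
  arity_unit := O.arity_unit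
  arity_comp q y := by
    obtain ⟨x, rfl⟩ := C.proj_surjective q
    have : ∀ i, ∃ z, C.proj z = y i := fun i => C.proj_surjective _
    choose z hz using this
    obtain rfl : (fun i => C.proj (z i)) = y := funext hz
    exact (congrArg C.classArity (C.proj_comp x z).symm).trans (O.arity_comp x z)
  unit_comp q := by
    obtain ⟨x, rfl⟩ := C.proj_surjective q
    exact (C.proj_comp O.unit fun _ => x).symm.trans (congrArg C.proj (O.unit_comp x))
  comp_unit q := by
    obtain ⟨x, rfl⟩ := C.proj_surjective q
    exact (C.proj_comp x fun _ => O.unit).symm.trans (congrArg C.proj (O.comp_unit x))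
  comp_assoc q y z := by
    obtain ⟨x, rfl⟩ := C.proj_surjective q
    have : ∀ i, ∃ z, C.proj z = y i := fun i => C.proj_surjective _
    choose v hv using this
    obtain rfl : (fun i => C.proj (v i)) = y := funext hv
    have h := C.proj_comp x v
    have : ∀ i, ∃ u, C.proj u = z i := fun i => C.proj_surjective _
    choose u hu using this
    obtain rfl : (fun i => C.proj (u i)) = z := funext hu
    have key : ∀ (c : C.Class) (hc : C.proj (O.comp x v) = c)
        (u : Fin (C.classArity c) → O.carrier),
        C.classComp c (fun i => C.proj (u i)) = C.classComp (C.proj x) fun i =>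
          C.classComp (C.proj (v i)) fun j => C.proj (u (Fin.cast
            ((O.arity_comp x v).symm.trans (congrArg C.classArity hc))
              (finSigmaFinEquiv ⟨i, j⟩))) := by
      rintro c rfl u
      refine (C.proj_comp (O.comp x v) u).symm.trans ?_
      rw [O.comp_assoc x v u, C.proj_comp]
      congr 1
      funext i
      rw [C.proj_comp]
      rfl
    exact key _ h u

end Congruence

end NSOperad

namespace NSOperad.Congruence

variable {S : Signature} (C : (freeOperad S).Congruence)

/-- Equivalent terms have the same degree. -/
class CompatibleWithDegree : Prop where
  deg_eq : ∀ t t' : Term S, C.r t t' → t.deg = t'.deg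

/-- All equivalence classes are finite. -/
class FiniteType : Prop where
  finite : ∀ t : Term S, {t' : Term S | C.r t t'}.Finite

instance quotient_graded [h : C.CompatibleWithDegree] : C.quotient.Graded := by
  let d : C.Class → ℕ := Quotient.lift Term.deg h.deg_eq
  refine ⟨⟨d, ?_, ?_⟩⟩
  · intro q
    obtain ⟨x, rfl⟩ := C.proj_surjective q
    refine (Term.deg_eq_zero_iff x).trans ⟨fun hx => congrArg C.proj hx, fun hx => ?_⟩
    exact (Term.deg_eq_zero_iff x).1 (h.deg_eq _ _ (C.proj_eq_iff.1 hx))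
  · intro q y
    obtain ⟨x, rfl⟩ := C.proj_surjective q
    have : ∀ i, ∃ z, C.proj z = y i := fun i => C.proj_surjective _
    choose z hz using this
    obtain rfl : (fun i => C.proj (z i)) = y := funext hz
    exact (congrArg d (C.proj_comp x z).symm).trans (Term.deg_graft x z)

instance quotient_finitelyFactorizable [h : C.FiniteType] :
    C.quotient.FinitelyFactorizable := by
  refine ⟨fun q => ?_⟩
  obtain ⟨t, rfl⟩ := C.proj_surjective q
  have h1 : Finite {t' : Term S | C.r t t'} := h.finite t
  have h2 : ∀ t' : Term S, Finite ((freeOperad S).Factorization t') :=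
    NSOperad.FinitelyFactorizable.finite (O := freeOperad S)
  let F : ((t' : {t' : Term S | C.r t t'}) × (freeOperad S).Factorization t'.1) →
      C.quotient.Factorization (C.proj t) := fun p =>
    ⟨⟨C.proj p.2.1.1, fun i => C.proj (p.2.1.2 i)⟩, by
      refine (C.proj_comp p.2.1.1 p.2.1.2).symm.trans ?_
      rw [p.2.2]
      exact (C.proj_eq_iff.2 p.1.2).symm⟩
  refine Finite.of_surjective F ?_
  rintro ⟨⟨q, y⟩, hq⟩
  obtain ⟨x, rfl⟩ := C.proj_surjective q
  have : ∀ i, ∃ z, C.proj z = y i := fun i => C.proj_surjective _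
  choose z hz using this
  obtain rfl : (fun i => C.proj (z i)) = y := funext hz
  refine ⟨⟨⟨(freeOperad S).comp x z, ?_⟩, ⟨⟨x, z⟩, rfl⟩⟩, rfl⟩
  exact C.proj_eq_iff.1 (hq.symm.trans (C.proj_comp x z).symm)

end NSOperad.Congruence

/-! ### Natural Hopf algebras -/

noncomputable section

namespace NSOperad

variable (O : NSOperad)

/-- The reduced words: the words on the elements of `O` other than the unit. -/
abbrev ReducedWord := FreeMonoid {x : O.carrier // x ≠ O.unit}

/-- The reduced word made of the letters of a word other than the unit. -/
def rd (w : List O.carrier) : O.ReducedWord :=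
  open Classical in
  FreeMonoid.ofList (w.filterMap fun x => if h : x ≠ O.unit then some ⟨x, h⟩ else none)

theorem rd_nil : O.rd [] = 1 := rfl

theorem rd_append (v w : List O.carrier) : O.rd (v ++ w) = O.rd v * O.rd w := by
  simp [rd, List.filterMap_append, FreeMonoid.ofList_append]

theorem rd_unit : O.rd [O.unit] = 1 := by
  simp [rd]

theorem rd_singleton (x : {x : O.carrier // x ≠ O.unit}) : O.rd [x.1] = FreeMonoid.of x := by
  simp [rd, x.2]

theorem rd_flatten (l : List (List O.carrier)) : O.rd l.flatten = (l.map O.rd).prod := by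
  induction l with
  | nil => rfl
  | cons a l ih => simp [rd_append, ih]

theorem rd_ofFn {n : ℕ} (w : Fin n → O.carrier) :
    O.rd (List.ofFn w) = (List.ofFn fun i => O.rd [w i]).prod := by
  induction n with
  | zero => rfl
  | succ n ih =>
    rw [List.ofFn_succ, List.ofFn_succ, List.prod_cons, ← ih, ← rd_append]
    rfl

/-- The underlying space of the natural Hopf algebra: finite linear combinations of reduced
words, with the concatenation product. -/
def NatHopf (K : Type*) [CommRing K] : Type _ := MonoidAlgebra K O.ReducedWord

namespace NatHopf

variable (K : Type*) [CommRing K]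

instance : Ring (O.NatHopf K) := inferInstanceAs (Ring (MonoidAlgebra K O.ReducedWord))

instance : Algebra K (O.NatHopf K) := inferInstanceAs (Algebra K (MonoidAlgebra K O.ReducedWord))

/-- The elementary basis. -/
def E : Module.Basis O.ReducedWord K (O.NatHopf K) := MonoidAlgebra.basis O.ReducedWord K

/-- The algebra morphism with prescribed values on the generators `E x`, for `x` in `O` other
than the unit. -/
def lift {A : Type*} [Semiring A] [Algebra K A] (f : {x : O.carrier // x ≠ O.unit} → A) :
    O.NatHopf K →ₐ[K] A :=
  MonoidAlgebra.lift K A O.ReducedWord (FreeMonoid.lift f)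

variable {O}

theorem E_mul (v w : O.ReducedWord) : E O K v * E O K w = E O K (v * w) := by
  refine (MonoidAlgebra.single_mul_single ..).trans ?_
  rw [one_mul]
  rfl

theorem E_one : E O K 1 = 1 := rfl

theorem lift_E {A : Type*} [Semiring A] [Algebra K A] (f : {x : O.carrier // x ≠ O.unit} → A)
    (w : O.ReducedWord) : lift O K f (E O K w) = FreeMonoid.lift f w := by
  refine (MonoidAlgebra.lift_single ..).trans ?_
  rw [one_smul]

theorem algHom_ext {A : Type*} [Semiring A] [Algebra K A] {f g : O.NatHopf K →ₐ[K] A}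
    (h : ∀ x, f (E O K (FreeMonoid.of x)) = g (E O K (FreeMonoid.of x))) : f = g := by
  apply AlgHom.toLinearMap_injective
  refine (E O K).ext fun w => ?_
  induction w using FreeMonoid.recOn with
  | one => rw [E_one]; simp
  | of_mul x w ih =>
    rw [← E_mul]
    simp only [AlgHom.toLinearMap_apply, map_mul] at ih ⊢
    rw [h, ih]

variable (O) in
/-- The coproduct of `E x`: the sum of `E (rd y) ⊗ E (rd w)` over all factorizations
`x = y[w₁, …, wₙ]`. -/
def comulGen (x : O.carrier) : O.NatHopf K ⊗[K] O.NatHopf K :=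
  ∑ᶠ p : O.Factorization x, E O K (O.rd [p.1.1]) ⊗ₜ[K] E O K (O.rd (List.ofFn p.1.2))

variable (O) in
/-- The coproduct, an algebra morphism. -/
def comulHom : O.NatHopf K →ₐ[K] O.NatHopf K ⊗[K] O.NatHopf K :=
  lift O K fun x => comulGen O K x.1

variable (O) in
/-- The counit, an algebra morphism which vanishes on the reduced words other than the empty
one. -/
def counitHom : O.NatHopf K →ₐ[K] K := lift O K fun _ => 0

theorem counitHom_E_rd (l : List O.carrier) :
    counitHom O K (E O K (O.rd l)) =
      open Classical in if ∀ x ∈ l, x = O.unit then 1 else 0 := by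
  induction l with
  | nil => simp [rd_nil, E_one]
  | cons x l ih =>
    have h1 : x :: l = [x] ++ l := rfl
    rw [congrArg O.rd h1, rd_append, ← E_mul, map_mul, ih]
    by_cases hx : x = O.unit
    · subst hx
      rw [rd_unit, E_one, map_one, one_mul]
      by_cases hl : ∀ x ∈ l, x = O.unit
      · rw [if_pos hl, if_pos (by simpa using hl)]
      · rw [if_neg hl, if_neg (by simpa using hl)]
    · rw [rd_singleton O ⟨x, hx⟩, counitHom, lift_E]
      rw [FreeMonoid.lift_eval_of, zero_mul, if_neg]
      exact fun h => hx (h x List.mem_cons_self)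

theorem prod_ofFn_sum {A : Type*} [Semiring A] {n : ℕ} {F : Fin n → Type*} [∀ i, Fintype (F i)]
    (f : ∀ i, F i → A) :
    (List.ofFn fun i => ∑ p, f i p).prod = ∑ p : ∀ i, F i, (List.ofFn fun i => f i (p i)).prod := by
  induction n with
  | zero => simp
  | succ n ih =>
    rw [List.ofFn_succ, List.prod_cons, ih, Finset.sum_mul_sum, ← Fintype.sum_prod_type',
      ← (Fin.consEquiv F).sum_comp]
    refine Finset.sum_congr rfl fun p _ => ?_
    simp [List.ofFn_succ, Fin.consEquiv]

theorem prod_ofFn_tmul {n : ℕ} (a b : Fin n → O.ReducedWord) :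
    (List.ofFn fun i => E O K (a i) ⊗ₜ[K] E O K (b i)).prod =
      E O K (List.ofFn a).prod ⊗ₜ[K] E O K (List.ofFn b).prod := by
  induction n with
  | zero => simp [E_one, Algebra.TensorProduct.one_def]
  | succ n ih =>
    simp [List.ofFn_succ, ih, ← E_mul, Algebra.TensorProduct.tmul_mul_tmul]

variable (O) in
/-- The two-level factorizations `x = (y[u₁, …, uₙ])[z₁, …, zₘ]`. -/
def Factorization₂ (x : O.carrier) :=
  {p : (y : O.carrier) × (u : Fin (O.arity y) → O.carrier) ×
    (Fin (O.arity (O.comp y u)) → O.carrier) // O.comp (O.comp p.1 p.2.1) p.2.2 = x}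

def equivLeft (x : O.carrier) :
    Factorization₂ O x ≃ (p : O.Factorization x) × O.Factorization p.1.1 where
  toFun p := ⟨⟨⟨O.comp p.1.1 p.1.2.1, p.1.2.2⟩, p.2⟩, ⟨⟨p.1.1, p.1.2.1⟩, rfl⟩⟩
  invFun p := ⟨⟨p.2.1.1, p.2.1.2, fun i => p.1.1.2 (Fin.cast (congrArg O.arity p.2.2) i)⟩, by
    obtain ⟨⟨⟨y', z⟩, h⟩, ⟨⟨y, u⟩, h'⟩⟩ := p
    simp only at h'
    subst h'
    exact h⟩
  left_inv p := rfl
  right_inv p := by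
    obtain ⟨⟨⟨y', z⟩, h⟩, ⟨⟨y, u⟩, h'⟩⟩ := p
    simp only at h'
    subst h'
    rfl

def toRight (x : O.carrier) (p : Factorization₂ O x) :
    (p : O.Factorization x) × ∀ i, O.Factorization (p.1.2 i) :=
  ⟨⟨⟨p.1.1, fun i => O.comp (p.1.2.1 i) fun j =>
    p.1.2.2 (Fin.cast (O.arity_comp _ _).symm (finSigmaFinEquiv ⟨i, j⟩))⟩,
      (O.comp_assoc _ _ _).symm.trans p.2⟩, fun i => ⟨⟨p.1.2.1 i, fun j =>
        p.1.2.2 (Fin.cast (O.arity_comp _ _).symm (finSigmaFinEquiv ⟨i, j⟩))⟩, rfl⟩⟩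

def ofRight (x : O.carrier) (p : (p : O.Factorization x) × ∀ i, O.Factorization (p.1.2 i)) :
    (y : O.carrier) × (u : Fin (O.arity y) → O.carrier) ×
      (Fin (O.arity (O.comp y u)) → O.carrier) :=
  ⟨p.1.1.1, fun i => (p.2 i).1.1, fun k =>
      (p.2 (finSigmaFinEquiv.symm (Fin.cast (O.arity_comp _ _) k)).1).1.2
        (finSigmaFinEquiv.symm (Fin.cast (O.arity_comp _ _) k)).2⟩

theorem toRight_bijective (x : O.carrier) : Function.Bijective (toRight (O := O) x) := by
  constructor
  · have h : ∀ p, ofRight x (toRight x p) = p.1 := by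
      rintro ⟨⟨y, u, z⟩, h⟩
      refine Sigma.ext rfl (heq_of_eq (Sigma.ext rfl (heq_of_eq ?_)))
      funext k
      change z _ = z k
      congr 1
      apply Fin.ext
      have := Equiv.apply_symm_apply (finSigmaFinEquiv (n := fun i => O.arity (u i)))
        (Fin.cast (O.arity_comp y u) k)
      rw [Fin.ext_iff] at this
      exact this
    intro p q hpq
    exact Subtype.ext ((h p).symm.trans ((congrArg (ofRight x) hpq).trans (h q)))
  · rintro ⟨⟨⟨y, w⟩, h⟩, p⟩
    obtain ⟨u, hu, rfl⟩ : ∃ (u : (i : Fin (O.arity y)) →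
        (v : O.carrier) × (Fin (O.arity v) → O.carrier))
        (hu : ∀ i, O.comp (u i).1 (u i).2 = w i), p = fun i => ⟨u i, hu i⟩ :=
      ⟨fun i => (p i).1, fun i => (p i).2, rfl⟩
    obtain rfl : (fun i => O.comp (u i).1 (u i).2) = w := funext hu
    obtain ⟨a, z, rfl⟩ : ∃ (a : Fin (O.arity y) → O.carrier)
        (z : Fin (O.arity (O.comp y a)) → O.carrier),
        u = fun i => ⟨a i, fun j =>
          z (Fin.cast (O.arity_comp _ _).symm (finSigmaFinEquiv ⟨i, j⟩))⟩ := by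
      refine ⟨fun i => (u i).1, fun k =>
        (u (finSigmaFinEquiv.symm (Fin.cast (O.arity_comp _ _) k)).1).2
          (finSigmaFinEquiv.symm (Fin.cast (O.arity_comp _ _) k)).2, ?_⟩
      funext i
      refine Sigma.ext rfl (heq_of_eq ?_)
      funext j
      exact (finSigmaFinEquiv_symm_apply' (fun i => (u i).2) i j).symm
    exact ⟨⟨⟨y, a, z⟩, (O.comp_assoc _ _ _).trans h⟩, rfl⟩

theorem comulGen_eq (x : O.carrier) [Fintype (O.Factorization x)] :
    comulGen O K x =
      ∑ p : O.Factorization x, E O K (O.rd [p.1.1]) ⊗ₜ[K] E O K (O.rd (List.ofFn p.1.2)) :=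
  finsum_eq_sum_of_fintype _

section

variable [hf : O.FinitelyFactorizable]

instance (x : O.carrier) : Fintype (O.Factorization x) :=
  have := hf.finite x
  Fintype.ofFinite _

variable [hg : O.Graded]

theorem comulGen_unit : comulGen O K O.unit = 1 := by
  obtain ⟨deg, hd⟩ := hg.exists_grading
  rw [comulGen_eq]
  have key : ∀ p : O.Factorization O.unit, p.1.1 = O.unit ∧ ∀ i, p.1.2 i = O.unit := by
    rintro ⟨⟨y, w⟩, h⟩
    have h1 := hd.comp y w
    simp only at h
    rw [h, (hd.eq_zero_iff _).2 rfl] at h1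
    have h2 : deg y = 0 := by omega
    have h3 : ∑ i, deg (w i) = 0 := by omega
    refine ⟨(hd.eq_zero_iff _).1 h2, fun i => (hd.eq_zero_iff _).1 ?_⟩
    exact (Finset.sum_eq_zero_iff.1 h3) i (Finset.mem_univ _)
  let p₀ : O.Factorization O.unit := ⟨⟨O.unit, fun _ => O.unit⟩, O.unit_comp _⟩
  rw [Finset.sum_eq_single p₀]
  · have h2 : List.ofFn (fun _ : Fin (O.arity O.unit) => O.unit) = [O.unit] := by
      rw [List.ofFn_congr O.arity_unit]
      simp
    simp only [p₀]
    rw [h2, rd_unit, E_one]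
    rfl
  · rintro p - hp
    exfalso
    apply hp
    obtain ⟨⟨y, w⟩, h⟩ := p
    obtain ⟨h1, h2⟩ := key ⟨⟨y, w⟩, h⟩
    simp only at h1 h2
    subst h1
    obtain rfl : w = fun _ => O.unit := funext h2
    rfl
  · simp

theorem comulHom_E_rd_singleton (x : O.carrier) :
    comulHom O K (E O K (O.rd [x])) = comulGen O K x := by
  by_cases hx : x = O.unit
  · subst hx
    rw [rd_unit, E_one, map_one, comulGen_unit]
  · rw [rd_singleton O ⟨x, hx⟩, comulHom, lift_E, FreeMonoid.lift_eval_of]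

theorem comulHom_E_rd (l : List O.carrier) :
    comulHom O K (E O K (O.rd l)) = (l.map (comulGen O K)).prod := by
  induction l with
  | nil => simp [rd_nil, E_one]
  | cons x l ih =>
    have h1 : x :: l = [x] ++ l := rfl
    rw [h1, rd_append, ← E_mul, map_mul, ih, comulHom_E_rd_singleton]
    simp


instance (x : O.carrier) : Fintype (Factorization₂ O x) :=
  Fintype.ofEquiv _ (equivLeft x).symm

variable (O) in
theorem comulHom_coassoc :
    (Algebra.TensorProduct.assoc K K K (O.NatHopf K) (O.NatHopf K) (O.NatHopf K)).toAlgHom.comp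
      ((Algebra.TensorProduct.map (comulHom O K) (.id K _)).comp (comulHom O K)) =
    (Algebra.TensorProduct.map (.id K _) (comulHom O K)).comp (comulHom O K) := by
  refine algHom_ext K fun x => ?_
  obtain ⟨x, hx⟩ := x
  rw [← rd_singleton O ⟨x, hx⟩]
  have h1 : (Algebra.TensorProduct.map (comulHom O K) (.id K _)) (comulGen O K x) =
      ∑ q : Factorization₂ O x, (E O K (O.rd [q.1.1]) ⊗ₜ[K] E O K (O.rd (List.ofFn q.1.2.1)))
        ⊗ₜ[K] E O K (O.rd (List.ofFn q.1.2.2)) := by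
    rw [comulGen_eq, map_sum]
    simp only [Algebra.TensorProduct.map_tmul, comulHom_E_rd_singleton, comulGen_eq,
      TensorProduct.sum_tmul, AlgHom.id_apply]
    rw [← Fintype.sum_sigma', ← (equivLeft x).sum_comp]
    rfl
  have h2 : (Algebra.TensorProduct.map (.id K _) (comulHom O K)) (comulGen O K x) =
      ∑ q : Factorization₂ O x, E O K (O.rd [q.1.1]) ⊗ₜ[K] (E O K (O.rd (List.ofFn q.1.2.1))
        ⊗ₜ[K] E O K (O.rd (List.ofFn q.1.2.2))) := by
    have h3 : ∀ {n : ℕ} (w : Fin n → O.carrier), comulHom O K (E O K (O.rd (List.ofFn w))) =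
        ∑ p : ∀ i, O.Factorization (w i), E O K (O.rd (List.ofFn fun i => (p i).1.1)) ⊗ₜ[K]
          E O K (O.rd (List.ofFn fun i => List.ofFn (p i).1.2).flatten) := by
      intro n w
      rw [comulHom_E_rd, List.map_ofFn]
      refine (congrArg (fun f => (List.ofFn f).prod) (funext fun i => comulGen_eq K (w i))).trans ?_
      rw [prod_ofFn_sum]
      refine Finset.sum_congr rfl fun p _ => ?_
      rw [prod_ofFn_tmul, rd_flatten, List.map_ofFn]
      congr 2
      exact (rd_ofFn O _).symm
    rw [comulGen_eq, map_sum]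
    simp only [Algebra.TensorProduct.map_tmul, h3, TensorProduct.tmul_sum, AlgHom.id_apply]
    rw [← Fintype.sum_sigma', ← (toRight_bijective x).sum_comp]
    refine Finset.sum_congr rfl fun q _ => ?_
    congr 3
    rw [List.ofFn_congr (O.arity_comp q.1.1 q.1.2.1), ofFn_finSigmaFinEquiv]
    rfl
  simp only [AlgHom.comp_apply, comulHom_E_rd_singleton]
  rw [h1, h2]
  simp

variable (O) in
theorem comulHom_rTensor :
    (Algebra.TensorProduct.map (counitHom O K) (.id K _)).comp (comulHom O K) =
      (Algebra.TensorProduct.lid K (O.NatHopf K)).symm := by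
  refine algHom_ext K fun x => ?_
  obtain ⟨x, hx⟩ := x
  rw [← rd_singleton O ⟨x, hx⟩]
  simp only [AlgHom.comp_apply, comulHom_E_rd_singleton]
  rw [comulGen_eq, map_sum]
  let p₀ : O.Factorization x := ⟨⟨O.unit, fun _ => x⟩, O.unit_comp x⟩
  rw [Finset.sum_eq_single p₀]
  · have h2 : List.ofFn (fun _ : Fin (O.arity O.unit) => x) = [x] := by
      rw [List.ofFn_congr O.arity_unit]
      simp
    simp [p₀, h2, counitHom_E_rd]
  · rintro ⟨⟨y, w⟩, h⟩ - hp
    have : y ≠ O.unit := by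
      rintro rfl
      apply hp
      simp only at h
      have h3 : w = fun _ => w (Fin.cast O.arity_unit.symm 0) := by
        funext i
        congr 1
        apply Fin.ext
        have := i.2
        have := O.arity_unit
        simp
        omega
      rw [h3, O.unit_comp] at h
      rw [h] at h3
      subst h3
      rfl
    simp [counitHom_E_rd, this]
  · simp

variable (O) in
theorem comulHom_lTensor :
    (Algebra.TensorProduct.map (.id K _) (counitHom O K)).comp (comulHom O K) =
      (Algebra.TensorProduct.rid K K (O.NatHopf K)).symm := by
  refine algHom_ext K fun x => ?_
  obtain ⟨x, hx⟩ := x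
  rw [← rd_singleton O ⟨x, hx⟩]
  simp only [AlgHom.comp_apply, comulHom_E_rd_singleton]
  rw [comulGen_eq, map_sum]
  let p₀ : O.Factorization x := ⟨⟨x, fun _ => O.unit⟩, O.comp_unit x⟩
  rw [Finset.sum_eq_single p₀]
  · simp [p₀, counitHom_E_rd]
  · rintro ⟨⟨y, w⟩, h⟩ - hp
    have : ¬ ∀ i, w i = O.unit := by
      intro hw
      apply hp
      simp only at h
      obtain rfl : w = fun _ => O.unit := funext hw
      rw [O.comp_unit] at h
      subst h
      rfl
    have h4 : ¬ ∀ a ∈ List.ofFn w, a = O.unit := by simpa [List.mem_ofFn] using this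
    rw [Algebra.TensorProduct.map_tmul, counitHom_E_rd, if_neg h4, TensorProduct.tmul_zero]
  · simp

/-- The bialgebra structure: the product is the concatenation of reduced words, the coproduct is
`comulHom`, the counit is `counitHom`. -/
instance : Bialgebra K (O.NatHopf K) :=
  Bialgebra.ofAlgHom (comulHom O K) (counitHom O K) (comulHom_coassoc O K)
    (comulHom_rTensor O K) (comulHom_lTensor O K)

end

theorem conv_ext {f g : WithConv (O.NatHopf K →ₗ[K] O.NatHopf K)}
    (h : ∀ w, f (E O K w) = g (E O K w)) : f = g :=
  WithConv.ofConv_injective ((E O K).ext h)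

section

variable [O.Graded]

variable (O) in
/-- The sum of the degrees of the letters of a reduced word, for some grading of `O`. -/
def wordDeg (w : O.ReducedWord) : ℕ :=
  (w.toList.map fun x => (Graded.exists_grading (O := O)).choose x.1).sum

theorem wordDeg_mul (v w : O.ReducedWord) : wordDeg O (v * w) = wordDeg O v + wordDeg O w := by
  simp [wordDeg, FreeMonoid.toList_mul]

theorem wordDeg_rd (l : List O.carrier) :
    wordDeg O (O.rd l) = (l.map (Graded.exists_grading (O := O)).choose).sum := by
  have hd := (Graded.exists_grading (O := O)).choose_spec
  induction l with
  | nil => rfl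
  | cons x l ih =>
    have h1 : x :: l = [x] ++ l := rfl
    rw [h1, rd_append, wordDeg_mul, ih]
    by_cases hx : x = O.unit
    · subst hx
      rw [rd_unit]
      simp [(hd.eq_zero_iff _).2 rfl, wordDeg]
    · rw [rd_singleton O ⟨x, hx⟩]
      simp [wordDeg]

theorem wordDeg_eq_zero (w : O.ReducedWord) (h : wordDeg O w = 0) : w = 1 := by
  have hd := (Graded.exists_grading (O := O)).choose_spec
  induction w using FreeMonoid.recOn with
  | one => rfl
  | of_mul x w ih =>
    exfalso
    rw [wordDeg_mul] at h
    have h1 : wordDeg O (FreeMonoid.of x) = 0 := by omega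
    rw [← rd_singleton O x, wordDeg_rd] at h1
    exact x.2 ((hd.eq_zero_iff _).1 (by simpa using h1))

variable (O) in
/-- The homogeneous component of degree `n` of the tensor square. -/
def tensorDeg (n : ℕ) : Submodule K (O.NatHopf K ⊗[K] O.NatHopf K) :=
  Submodule.span K {t | ∃ a b, wordDeg O a + wordDeg O b = n ∧ t = E O K a ⊗ₜ[K] E O K b}

variable [O.FinitelyFactorizable]

theorem comul_mem_tensorDeg (w : O.ReducedWord) :
    comulHom O K (E O K w) ∈ tensorDeg O K (wordDeg O w) := by
  have hd := (Graded.exists_grading (O := O)).choose_spec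
  induction w using FreeMonoid.recOn with
  | one =>
    rw [E_one, map_one]
    exact Submodule.subset_span ⟨1, 1, rfl, rfl⟩
  | of_mul x w ih =>
    rw [← E_mul, map_mul, wordDeg_mul]
    have h1 : comulHom O K (E O K (FreeMonoid.of x)) ∈
        tensorDeg O K (wordDeg O (FreeMonoid.of x)) := by
      rw [← rd_singleton O x, comulHom_E_rd_singleton, comulGen_eq]
      refine Submodule.sum_mem _ fun p _ => Submodule.subset_span ⟨_, _, ?_, rfl⟩
      rw [wordDeg_rd, wordDeg_rd, wordDeg_rd]
      have h2 := hd.comp p.1.1 p.1.2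
      rw [p.2] at h2
      simp [h2, List.sum_ofFn, List.map_ofFn]
    have h3 := Submodule.mul_mem_mul h1 ih
    rw [tensorDeg, tensorDeg, Submodule.span_mul_span] at h3
    refine Submodule.span_mono ?_ h3
    rintro _ ⟨_, ⟨a, b, hab, rfl⟩, _, ⟨c, d, hcd, rfl⟩, rfl⟩
    refine ⟨a * c, b * d, ?_, ?_⟩
    · rw [wordDeg_mul, wordDeg_mul, ← hab, ← hcd]
      ring
    · simp [← E_mul, Algebra.TensorProduct.tmul_mul_tmul]

open WithConv

theorem convMul_congr (w : O.ReducedWord) (f g f' g' : WithConv (O.NatHopf K →ₗ[K] O.NatHopf K))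
    (h : ∀ a b, wordDeg O a + wordDeg O b = wordDeg O w →
      f (E O K a) * g (E O K b) = f' (E O K a) * g' (E O K b)) :
    (f * g) (E O K w) = (f' * g') (E O K w) := by
  rw [LinearMap.convMul_apply, LinearMap.convMul_apply]
  refine LinearMap.eqOn_span (f := LinearMap.mul' K _ ∘ₗ TensorProduct.map f.ofConv g.ofConv)
    (g := LinearMap.mul' K _ ∘ₗ TensorProduct.map f'.ofConv g'.ofConv) ?_
    (comul_mem_tensorDeg K w)
  rintro _ ⟨a, b, hab, rfl⟩
  exact h a b hab

variable (O) in
/-- The convolution unit minus the identity. -/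
def oneSubId : WithConv (O.NatHopf K →ₗ[K] O.NatHopf K) := 1 - toConv LinearMap.id

theorem oneSubId_E_one : oneSubId O K (E O K 1) = 0 := by
  simp [oneSubId, E_one]

theorem oneSubId_pow (n : ℕ) (w : O.ReducedWord) (h : wordDeg O w < n) :
    (oneSubId O K ^ n) (E O K w) = 0 := by
  induction n generalizing w with
  | zero => omega
  | succ n ih =>
    rw [pow_succ', convMul_congr K w _ _ 0 0, zero_mul]
    · rfl
    · intro a b hab
      by_cases ha : wordDeg O a = 0
      · rw [wordDeg_eq_zero a ha, oneSubId_E_one, zero_mul]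
        exact (zero_mul _).symm
      · rw [ih b (by omega), mul_zero]
        exact (zero_mul _).symm

variable (O) in
/-- The antipode, as a geometric series for the convolution product. -/
def antipodeMap : O.NatHopf K →ₗ[K] O.NatHopf K :=
  (E O K).constr K fun w => (∑ k ∈ Finset.range (wordDeg O w + 1), oneSubId O K ^ k) (E O K w)

theorem antipodeMap_E (w : O.ReducedWord) (n : ℕ) (h : wordDeg O w < n) :
    antipodeMap O K (E O K w) = (∑ k ∈ Finset.range n, oneSubId O K ^ k) (E O K w) := by
  rw [antipodeMap, Module.Basis.constr_basis]
  have : ∀ m, (∑ k ∈ Finset.range m, oneSubId O K ^ k) (E O K w) =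
      ∑ k ∈ Finset.range m, (oneSubId O K ^ k) (E O K w) := by
    intro m
    induction m with
    | zero => rfl
    | succ m ih => rw [Finset.sum_range_succ, Finset.sum_range_succ, ← ih]; rfl
  rw [this, this]
  refine Finset.sum_subset (Finset.range_mono h) fun k _ hk => oneSubId_pow K k w ?_
  simpa using hk

theorem toConv_id : toConv LinearMap.id = 1 - oneSubId O K := by
  simp [oneSubId]

theorem one_sub_pow_E (w : O.ReducedWord) :
    (1 - oneSubId O K ^ (wordDeg O w + 1)) (E O K w) =
      (1 : WithConv (O.NatHopf K →ₗ[K] O.NatHopf K)) (E O K w) := by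
  refine Eq.trans (b := (1 : WithConv (O.NatHopf K →ₗ[K] O.NatHopf K)) (E O K w) -
    (oneSubId O K ^ (wordDeg O w + 1)) (E O K w)) rfl ?_
  rw [oneSubId_pow K _ w (Nat.lt_succ_self _), sub_zero]

theorem antipodeMap_conv_id : toConv (antipodeMap O K) * toConv LinearMap.id = 1 := by
  refine conv_ext K fun w => ?_
  rw [convMul_congr K w _ _ (∑ k ∈ Finset.range (wordDeg O w + 1), oneSubId O K ^ k)
    (1 - oneSubId O K), geom_sum_mul_neg, one_sub_pow_E]
  intro a b hab
  rw [← toConv_id, ← antipodeMap_E K a _ (by omega)]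

theorem id_conv_antipodeMap : toConv LinearMap.id * toConv (antipodeMap O K) = 1 := by
  refine conv_ext K fun w => ?_
  rw [convMul_congr K w _ _ (1 - oneSubId O K)
    (∑ k ∈ Finset.range (wordDeg O w + 1), oneSubId O K ^ k), mul_neg_geom_sum, one_sub_pow_E]
  intro a b hab
  rw [← toConv_id, ← antipodeMap_E K b _ (by omega)]

/-- The natural Hopf algebra of a finitely factorizable graded operad. -/
instance : HopfAlgebra K (O.NatHopf K) :=
  HopfAlgebra.ofConvInverse (antipodeMap O K) (antipodeMap_conv_id K) (id_conv_antipodeMap K)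

end

end NatHopf

end NSOperad

/-! ### The morphism -/

namespace NSOperad.Congruence

variable {S : Signature} (C : (freeOperad S).Congruence)

/-- The reduced forests which project, letter by letter, to the reduced word `x` of classes. -/
def forestsOver (x : C.quotient.ReducedWord) : Set (freeOperad S).ReducedWord :=
  {f | f.toList.map (fun t => C.proj t.1) = x.toList.map Subtype.val}

/-- The linear map sending `E x` to the sum of `E f` over the reduced forests `f` projecting
to `x`. -/
def phi (K : Type*) [CommRing K] : C.quotient.NatHopf K →ₗ[K] (freeOperad S).NatHopf K :=
  (NatHopf.E C.quotient K).constr K fun x => ∑ᶠ f ∈ C.forestsOver x, NatHopf.E (freeOperad S) K f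

end NSOperad.Congruence

end

/-!
An element of `N(O)` is a finitely supported function on the reduced words of `O`, and `φ` is the
pullback of such functions along the letterwise projection of words, which is onto and has finite
fibers. Hence `φ` is injective, and it is multiplicative because a lift of a word is a word of
lifts of its letters. It respects the coproducts because choosing a lift `x` of a class `q` and a
factorization of `x` amounts to choosing a factorization of `q` and lifts of its factors. The
antipodes take care of themselves: `φ ∘ S` and `S ∘ φ` are both inverse to `φ` for the convolution
product.
-/

noncomputable section

theorem map_antipode_of_bialgHom {R A B : Type*} [CommSemiring R] [Semiring A] [Semiring B]
    [HopfAlgebra R A] [HopfAlgebra R B] (f : A →ₐc[R] B) (a : A) :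
    f (HopfAlgebra.antipode R a) = HopfAlgebra.antipode R (f a) := by
  let F : WithConv (A →ₗ[R] B) := .toConv (f : A →ₗc[R] B).toLinearMap
  have left_inv : .toConv ((f : A →ₐ[R] B).toLinearMap ∘ₗ HopfAlgebra.antipode R) * F = 1 := by
    have h := LinearMap.algHom_comp_convMul_distrib (f : A →ₐ[R] B)
      (.toConv (HopfAlgebra.antipode R)) (.toConv LinearMap.id : WithConv (A →ₗ[R] A))
    rw [LinearMap.antipode_mul_id] at h
    refine WithConv.ofConv_injective (h.symm.trans ?_)
    ext x
    simpa using AlgHomClass.commutes f (Coalgebra.counit (R := R) x)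
  have right_inv : F * .toConv (HopfAlgebra.antipode R ∘ₗ (f : A →ₗc[R] B).toLinearMap) = 1 := by
    have h := LinearMap.convMul_comp_coalgHom_distrib
      (.toConv LinearMap.id : WithConv (B →ₗ[R] B)) (.toConv (HopfAlgebra.antipode R))
      (f : A →ₗc[R] B)
    rw [LinearMap.id_mul_antipode] at h
    refine WithConv.ofConv_injective (h.symm.trans ?_)
    ext x
    simp
  exact congrArg (fun g : WithConv (A →ₗ[R] B) => g a) (left_inv_eq_right_inv left_inv right_inv)

theorem finsum_mem_image2_mul {α β γ A : Type*} [NonUnitalNonAssocSemiring A] {s : Set α}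
    {t : Set β} (hs : s.Finite) (ht : t.Finite) {m : α → β → γ} (hm : Function.Injective2 m)
    {φ : γ → A} {u : α → A} {v : β → A} (hφ : ∀ a b, φ (m a b) = u a * v b) :
    ∑ᶠ c ∈ Set.image2 m s t, φ c = (∑ᶠ a ∈ s, u a) * ∑ᶠ b ∈ t, v b := by
  lift s to Finset α using hs
  lift t to Finset β using ht
  rw [← Set.image_uncurry_prod, finsum_mem_image hm.uncurry.injOn, ← Finset.coe_product]
  simp only [finsum_mem_coe_finset, Function.uncurry_def, hφ, Finset.sum_mul_sum,
    Finset.sum_product]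

section LiftsOfWords

open FreeMonoid

variable {α β : Type*} (g : α → β)

theorem preimage_freeMonoidMap_of_mul (b : β) (w : FreeMonoid β) :
    map g ⁻¹' {of b * w} = Set.image2 (fun a f => of a * f) (g ⁻¹' {b}) (map g ⁻¹' {w}) := by
  ext f
  constructor
  · intro hf
    obtain ⟨a, f, rfl, ha, hf⟩ := List.map_eq_cons_iff.1 hf
    exact ⟨a, ha, f, hf, rfl⟩
  · rintro ⟨a, rfl, f, rfl, rfl⟩
    exact map_mul (map g) (of a) f

theorem preimage_freeMonoidMap_one : map g ⁻¹' {1} = {1} :=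
  Set.ext fun _ => List.map_eq_nil_iff

variable {g}

theorem finite_preimage_freeMonoidMap (hg : ∀ b, (g ⁻¹' {b}).Finite) (w : FreeMonoid β) :
    (map g ⁻¹' {w}).Finite := by
  induction w using FreeMonoid.recOn with
  | one => exact preimage_freeMonoidMap_one g ▸ Set.finite_singleton 1
  | of_mul b w ih => exact preimage_freeMonoidMap_of_mul g b w ▸ (hg b).image2 _ ih

theorem finsum_mem_preimage_freeMonoidMap {A : Type*} [Semiring A] (hg : ∀ b, (g ⁻¹' {b}).Finite)
    (h : FreeMonoid α →* A) (w : FreeMonoid β) :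
    ∑ᶠ f ∈ map g ⁻¹' {w}, h f = lift (fun b => ∑ᶠ a ∈ g ⁻¹' {b}, h (of a)) w := by
  induction w using FreeMonoid.recOn with
  | one => rw [preimage_freeMonoidMap_one, finsum_mem_singleton, map_one, map_one]
  | of_mul b w ih =>
    have of_mul_injective : Function.Injective2 fun (a : α) (f : FreeMonoid α) => of a * f :=
      fun _ _ _ _ => List.cons_eq_cons.1
    rw [preimage_freeMonoidMap_of_mul, finsum_mem_image2_mul (hg b)
      (finite_preimage_freeMonoidMap hg w) of_mul_injective fun _ _ => map_mul h _ _, ih, map_mul,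
      lift_eval_of]

end LiftsOfWords

namespace NSOperad

namespace NatHopf

variable (O : NSOperad) (K : Type*) [CommRing K]

/-- The elementary basis `E` as a morphism from the monoid of reduced words to the multiplicative
monoid of the algebra. -/
def EHom : O.ReducedWord →* O.NatHopf K where
  toFun := E O K
  map_one' := E_one K
  map_mul' v w := (E_mul K v w).symm

theorem E_rd_ofFn {n : ℕ} (w : Fin n → O.carrier) :
    E O K (O.rd (List.ofFn w)) = (List.ofFn fun i => E O K (O.rd [w i])).prod := by
  rw [rd_ofFn]
  exact (map_list_prod (EHom O K) _).trans (congrArg List.prod List.map_ofFn)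

end NatHopf

namespace Congruence

open NatHopf

variable {O : NSOperad} (C : O.Congruence)

/-- The elements of a class, as a type. -/
abbrev Fiber (q : C.quotient.carrier) := {x : O.carrier // C.proj x = q}

/-- The unit is alone in its class. This is what makes the letterwise projection of a reduced word
reduced. -/
class ReflectsUnit : Prop where
  eq_unit : ∀ x, C.proj x = C.quotient.unit → x = O.unit

/-- The reduced words which project, letter by letter, to the reduced word `x` of classes. -/
def wordsOver (x : C.quotient.ReducedWord) : Set O.ReducedWord :=
  {f | f.toList.map (fun t => C.proj t.1) = x.toList.map Subtype.val}

/-- The map `φ` for an arbitrary operad: it sends `E x` to the sum of `E f` over the reduced words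
`f` projecting to `x`. -/
def pullback (K : Type*) [CommRing K] : C.quotient.NatHopf K →ₗ[K] O.NatHopf K :=
  (E C.quotient K).constr K fun x => ∑ᶠ f ∈ C.wordsOver x, E O K f

section Words

variable [C.ReflectsUnit]

/-- The class of a letter of a reduced word, as a letter of the reduced words of classes. -/
def projLetter (t : {t : O.carrier // t ≠ O.unit}) :
    {q : C.quotient.carrier // q ≠ C.quotient.unit} :=
  ⟨C.proj t.1, fun h => t.2 (ReflectsUnit.eq_unit t.1 h)⟩

theorem projLetter_surjective : Function.Surjective C.projLetter := by
  rintro ⟨q, hq⟩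
  obtain ⟨t, rfl⟩ := C.proj_surjective q
  exact ⟨⟨t, fun h => hq (congrArg C.proj h)⟩, rfl⟩

theorem wordsOver_eq_preimage (x : C.quotient.ReducedWord) :
    C.wordsOver x = FreeMonoid.map C.projLetter ⁻¹' {x} := by
  ext f
  have map_val : (FreeMonoid.map C.projLetter f).toList.map Subtype.val =
      f.toList.map fun t => C.proj t.1 := List.map_map
  rw [Set.mem_preimage, Set.mem_singleton_iff, ← FreeMonoid.toList.injective.eq_iff,
    ← Subtype.val_injective.list_map.eq_iff, map_val]
  rfl

/-- A class other than the unit and the corresponding letter have the same elements. -/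
def fiberEquivPreimage (q : {q : C.quotient.carrier // q ≠ C.quotient.unit}) :
    C.Fiber q.1 ≃ C.projLetter ⁻¹' {q} where
  toFun t := ⟨⟨t.1, fun h => q.2 (t.2.symm.trans (congrArg C.proj h))⟩, Subtype.ext t.2⟩
  invFun a := ⟨a.1.1, congrArg Subtype.val a.2⟩

variable [∀ q, Finite (C.Fiber q)]

theorem finite_preimage_projLetter (q : {q : C.quotient.carrier // q ≠ C.quotient.unit}) :
    (C.projLetter ⁻¹' {q}).Finite :=
  (C.fiberEquivPreimage q).finite_iff.1 inferInstance

theorem finite_wordsOver (x : C.quotient.ReducedWord) : (C.wordsOver x).Finite :=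
  C.wordsOver_eq_preimage x ▸ finite_preimage_freeMonoidMap C.finite_preimage_projLetter x

variable (K : Type*) [CommRing K]

theorem pullback_E (x : C.quotient.ReducedWord) :
    C.pullback K (E C.quotient K x) = ∑ f ∈ (C.finite_wordsOver x).toFinset, E O K f := by
  rw [pullback, Module.Basis.constr_basis, finsum_mem_eq_finite_toFinset_sum]

theorem repr_pullback (a : C.quotient.NatHopf K) (f : O.ReducedWord) :
    (E O K).repr (C.pullback K a) f =
      (E C.quotient K).repr a (FreeMonoid.map C.projLetter f) := by
  classical
  have coord_comp : (E O K).coord f ∘ₗ C.pullback K =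
      (E C.quotient K).coord (FreeMonoid.map C.projLetter f) := by
    refine (E C.quotient K).ext fun x => ?_
    simp [pullback_E, wordsOver_eq_preimage, Finsupp.single_apply, eq_comm]
  exact LinearMap.congr_fun coord_comp a

theorem pullback_injective : Function.Injective (C.pullback K) := by
  intro a b h
  refine (E C.quotient K).ext_elem fun x => ?_
  obtain ⟨f, rfl⟩ := FreeMonoid.map_surjective.2 C.projLetter_surjective x
  rw [← repr_pullback, ← repr_pullback, h]

end Words

/-- Factorizations of the class `q` together with an element of the class of each factor. -/
abbrev LiftedFactorization (q : C.quotient.carrier) :=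
  (p : C.quotient.Factorization q) × C.Fiber p.1.1 × ∀ i, C.Fiber (p.1.2 i)

/-- Factorizing an element of the class `q` amounts to factorizing `q` and lifting the factors. -/
def factorizationEquivLifted (q : C.quotient.carrier) :
    (x : C.Fiber q) × O.Factorization x.1 ≃ C.LiftedFactorization q where
  toFun p := ⟨⟨⟨C.proj p.2.1.1, fun i => C.proj (p.2.1.2 i)⟩,
    (C.proj_comp _ _).symm.trans ((congrArg C.proj p.2.2).trans p.1.2)⟩,
    ⟨p.2.1.1, rfl⟩, fun i => ⟨p.2.1.2 i, rfl⟩⟩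
  invFun p := ⟨⟨O.comp p.2.1.1 fun i => (p.2.2 (Fin.cast (congrArg C.classArity p.2.1.2) i)).1, by
      obtain ⟨⟨⟨r, w⟩, h⟩, ⟨y, hy⟩, z⟩ := p
      simp only at hy
      subst hy
      refine (C.proj_comp _ _).trans (Eq.trans ?_ h)
      exact congrArg (C.classComp (C.proj y)) (funext fun i => (z i).2)⟩,
    ⟨⟨_, _⟩, rfl⟩⟩
  left_inv := by
    rintro ⟨⟨x, hx⟩, ⟨⟨y, w⟩, h⟩⟩
    simp only at h
    subst h
    rfl
  right_inv := by
    rintro ⟨⟨⟨r, w⟩, h⟩, ⟨y, hy⟩, z⟩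
    simp only at hy
    subst hy
    obtain ⟨u, hu, rfl⟩ : ∃ (u : Fin (O.arity y) → O.carrier) (hu : ∀ i, C.proj (u i) = w i),
        z = fun i => ⟨u i, hu i⟩ := ⟨fun i => (z i).1, fun i => (z i).2, rfl⟩
    obtain rfl : (fun i => C.proj (u i)) = w := funext hu
    rfl

variable [∀ q, Fintype (C.Fiber q)] (K : Type*) [CommRing K]

/-- The sum of the elements of a class, as an element of the natural Hopf algebra; the unit of the
operad counts as `1`. -/
def classSum (q : C.quotient.carrier) : O.NatHopf K :=
  ∑ t : C.Fiber q, E O K (O.rd [t.1])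

/-- The morphism of algebras with the values of `pullback` on the generators. -/
def pullbackAlgHom : C.quotient.NatHopf K →ₐ[K] O.NatHopf K :=
  lift C.quotient K fun q => C.classSum K q.1

theorem counitHom_classSum {q : C.quotient.carrier} (hq : q ≠ C.quotient.unit) :
    counitHom O K (C.classSum K q) = 0 := by
  rw [classSum, map_sum]
  refine Finset.sum_eq_zero fun t _ => ?_
  rw [counitHom_E_rd, if_neg]
  simp only [List.mem_singleton, forall_eq]
  exact fun h => hq (t.2.symm.trans (congrArg C.proj h))

theorem counitHom_comp_pullbackAlgHom :
    (counitHom O K).comp (C.pullbackAlgHom K) = counitHom C.quotient K := by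
  refine algHom_ext K fun q => ?_
  rw [AlgHom.comp_apply, pullbackAlgHom, lift_E, FreeMonoid.lift_eval_of,
    C.counitHom_classSum K q.2, counitHom, lift_E, FreeMonoid.lift_eval_of]

variable [C.ReflectsUnit]

theorem finsum_mem_preimage_projLetter (q : {q : C.quotient.carrier // q ≠ C.quotient.unit}) :
    ∑ᶠ t ∈ C.projLetter ⁻¹' {q}, E O K (FreeMonoid.of t) = C.classSum K q.1 := by
  rw [← finsum_set_coe_eq_finsum_mem, ← finsum_comp_equiv (C.fiberEquivPreimage q),
    finsum_eq_sum_of_fintype, classSum]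
  exact Finset.sum_congr rfl fun t _ =>
    congrArg (E O K) (O.rd_singleton (C.fiberEquivPreimage q t).1).symm

theorem pullbackAlgHom_apply (a : C.quotient.NatHopf K) :
    C.pullbackAlgHom K a = C.pullback K a := by
  refine LinearMap.congr_fun (f := (C.pullbackAlgHom K).toLinearMap)
    ((E C.quotient K).ext fun x => ?_) a
  rw [AlgHom.toLinearMap_apply, pullbackAlgHom, lift_E, pullback, Module.Basis.constr_basis,
    wordsOver_eq_preimage]
  simp only [← finsum_mem_preimage_projLetter]
  exact (finsum_mem_preimage_freeMonoidMap C.finite_preimage_projLetter (EHom O K) x).symm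

theorem classSum_unit : C.classSum K C.quotient.unit = 1 := by
  let unitLift : C.Fiber C.quotient.unit := ⟨O.unit, rfl⟩
  rw [classSum, Fintype.sum_eq_single unitLift, rd_unit, E_one]
  exact fun t ht => absurd (Subtype.ext (ReflectsUnit.eq_unit t.1 t.2)) ht

theorem pullbackAlgHom_E_rd_singleton (q : C.quotient.carrier) :
    C.pullbackAlgHom K (E C.quotient K (C.quotient.rd [q])) = C.classSum K q := by
  by_cases hq : q = C.quotient.unit
  · rw [hq, rd_unit, E_one, map_one, classSum_unit]
  · rw [rd_singleton C.quotient ⟨q, hq⟩, pullbackAlgHom, lift_E, FreeMonoid.lift_eval_of]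

theorem pullbackAlgHom_E_rd_ofFn {n : ℕ} (w : Fin n → C.quotient.carrier) :
    C.pullbackAlgHom K (E C.quotient K (C.quotient.rd (List.ofFn w))) =
      ∑ t : ∀ i, C.Fiber (w i), E O K (O.rd (List.ofFn fun i => (t i).1)) := by
  rw [E_rd_ofFn, map_list_prod, List.map_ofFn]
  simp only [E_rd_ofFn, Function.comp_def, pullbackAlgHom_E_rd_singleton]
  exact prod_ofFn_sum _

variable [O.FinitelyFactorizable] [C.quotient.FinitelyFactorizable]

theorem map_pullbackAlgHom_comulGen (q : C.quotient.carrier) :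
    Algebra.TensorProduct.map (C.pullbackAlgHom K) (C.pullbackAlgHom K)
      (comulGen C.quotient K q) = ∑ t : C.Fiber q, comulGen O K t.1 := by
  calc
    _ = ∑ p : C.LiftedFactorization q, E O K (O.rd [p.2.1.1]) ⊗ₜ[K]
          E O K (O.rd (List.ofFn fun i => (p.2.2 i).1)) := by
      rw [comulGen_eq, map_sum, Fintype.sum_sigma]
      refine Finset.sum_congr rfl fun p _ => ?_
      rw [Algebra.TensorProduct.map_tmul, pullbackAlgHom_E_rd_singleton,
        pullbackAlgHom_E_rd_ofFn, classSum, TensorProduct.sum_tmul, Fintype.sum_prod_type]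
      simp only [TensorProduct.tmul_sum]
    _ = ∑ p : (t : C.Fiber q) × O.Factorization t.1, E O K (O.rd [p.2.1.1]) ⊗ₜ[K]
          E O K (O.rd (List.ofFn p.2.1.2)) :=
      ((C.factorizationEquivLifted q).sum_comp _).symm
    _ = _ := by
      rw [Fintype.sum_sigma]
      simp only [comulGen_eq]

variable [O.Graded] [C.quotient.Graded]

theorem map_pullbackAlgHom_comp_comulHom :
    (Algebra.TensorProduct.map (C.pullbackAlgHom K) (C.pullbackAlgHom K)).comp
      (comulHom C.quotient K) = (comulHom O K).comp (C.pullbackAlgHom K) := by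
  refine algHom_ext K fun q => ?_
  rw [AlgHom.comp_apply, AlgHom.comp_apply, ← rd_singleton, comulHom_E_rd_singleton,
    pullbackAlgHom_E_rd_singleton, map_pullbackAlgHom_comulGen, classSum, map_sum]
  simp only [comulHom_E_rd_singleton]

/-- The map `pullback` as a morphism of bialgebras. -/
def pullbackBialgHom : C.quotient.NatHopf K →ₐc[K] O.NatHopf K :=
  BialgHom.ofAlgHom (C.pullbackAlgHom K) (C.counitHom_comp_pullbackAlgHom K)
    (C.map_pullbackAlgHom_comp_comulHom K)

end Congruence

end NSOperad

theorem mainTheorem2_general {K : Type*} [CommRing K] {O : NSOperad} (C : O.Congruence)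
    [O.FinitelyFactorizable] [O.Graded] [C.quotient.FinitelyFactorizable] [C.quotient.Graded]
    [∀ q, Finite (C.Fiber q)] [C.ReflectsUnit] :
    (∀ x, (C.wordsOver x).Finite) ∧
      Function.Injective (C.pullback K) ∧
      ∃ Φ : C.quotient.NatHopf K →ₐc[K] O.NatHopf K,
        (∀ a, Φ a = C.pullback K a) ∧
        ∀ a, Φ (HopfAlgebra.antipode K a) = HopfAlgebra.antipode K (Φ a) := by
  have := fun q => Fintype.ofFinite (C.Fiber q)
  exact ⟨C.finite_wordsOver, C.pullback_injective K, C.pullbackBialgHom K,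
    C.pullbackAlgHom_apply K, map_antipode_of_bialgHom (C.pullbackBialgHom K)⟩

namespace NSOperad.Congruence

variable {S : Signature} (C : (freeOperad S).Congruence)

instance finite_fiber [C.FiniteType] (q : C.quotient.carrier) : Finite (C.Fiber q) := by
  obtain ⟨t, rfl⟩ := C.proj_surjective q
  exact (FiniteType.finite t).subset fun t' ht' => C.proj_eq_iff.1 (Eq.symm ht')

instance reflectsUnit [h : C.CompatibleWithDegree] : C.ReflectsUnit where
  eq_unit t ht := (Term.deg_eq_zero_iff t).1 (h.deg_eq _ _ (C.proj_eq_iff.1 ht))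

end NSOperad.Congruence

end

theorem mainTheorem2 {K : Type*} [Field K] [CharZero K] (S : Signature)
    (C : (freeOperad S).Congruence) [C.CompatibleWithDegree] [C.FiniteType] :
    (∀ x, (C.forestsOver x).Finite) ∧
      Function.Injective (C.phi K) ∧
      ∃ Φ : C.quotient.NatHopf K →ₐc[K] (freeOperad S).NatHopf K,
        (∀ a, Φ a = C.phi K a) ∧
        ∀ a, Φ (HopfAlgebra.antipode K a) = HopfAlgebra.antipode K (Φ a) :=
  mainTheorem2_general C
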